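/- **Partitions.** A two-coloured partition $p$ with $k\ge 0$ upper and $l\ge 0$ lower points is a partition of these $k+l$ points into blocks, together with colour words $\omega\in\{1,*\}^k$ (upper row) and $\omega'\in\{1,*\}^l$ (lower row). A through-block is a block containing both upper and lower points; $tb(p)$ is their number. For $N\ge 1$ put $[N]=\{1,\dots,N\}$. A labeling $t\in[N]^k$ of the upper row (or $t'\in[N]^l$ of the lower row) is valid if points of that row lying in the same block have equal labels. Let $T_0\subseteq[N]^k$ and $T'_0\subseteq[N]^l$ be the sets of invalid labelings. Enumerate the $r=N^{tb(p)}$ labelings of the through-blocks by elements of $[N]$ as $1,\dots,r$, and let $T_i\subseteq [N]^k$ and $T'_i\subseteq[N]^l$ be the sets of valid labelings of the upper and the lower row, respectively, that label the through-blocks according to the $i$-th one. The four mixed-coloured pair partitions are those consisting of a single block of two points, both in the same row (both upper or both lower), coloured $1*$ or $*1$. **Relations.** Write $a^1=a$ and let $a^*$ be the adjoint; empty products are $\mathbb 1$. For an $N\times N$-matrix $u=(u_{ij})$ the relations $R^{Gr}_p(u)$ are 1. $\sum_{t\in T_i}u_{t_1\gamma_1}^{\omega_1}\cdots u_{t_k\gamma_k}^{\omega_k}=\sum_{t'\in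 T'_j}u_{\gamma'_1t'_1}^{\omega'_1}\cdots u_{\gamma'_lt'_l}^{\omega'_l}$ for $1\le i,j\le r$, $\gamma\in T_j$, $\gamma'\in T'_i$; 2. $\sum_{t\in T_i}u_{t_1\gamma_1}^{\omega_1}\cdots u_{t_k\gamma_k}^{\omega_k}=0$ for $1\le i\le r$, $\gamma\in T_0$; 3. $\sum_{t'\in T'_j}u_{\gamma'_1t'_1}^{\omega'_1}\cdots u_{\gamma'_lt'_l}^{\omega'_l}=0$ for $1\le j\le r$, $\gamma'\in T'_0$. For $d\le N$ and $x=(x_{ij})_{1\le i\le N,\,1\le j\le d}$ the relations $R^{Sp}_p(x)$ are 1. $\sum_{t\in T_i}x_{t_1\gamma_1}^{\omega_1}\cdots x_{t_k\gamma_k}^{\omega_k}=\sum_{t'\in T'_i}x_{t'_1\gamma'_1}^{\omega'_1}\cdots x_{t'_l\gamma'_l}^{\omega'_l}$ for $1\le i,j\le r$, $\gamma\in T_j\cap[d]^k$, $\gamma'\in T'_j\cap[d]^l$; 2. $\sum_{t\in T_i}x_{t_1\gamma_1}^{\omega_1}\cdots x_{t_k\gamma_k}^{\omega_k}=0$ for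 $1\le i\le r$, $\gamma\in T_0\cap[d]^k$; 3. $\sum_{t'\in T'_i}x_{t'_1\gamma'_1}^{\omega'_1}\cdots x_{t'_l\gamma'_l}^{\omega'_l}=0$ for $1\le i\le r$, $\gamma'\in T'_0\cap[d]^l$. For one vector $x=(x_1,\dots,x_N)$ the relations $R^{Sp}_p(x)$ are $\sum_{t\in T_i}x_{t_1}^{\omega_1}\cdots x_{t_k}^{\omega_k}=\sum_{t'\in T'_i}x_{t'_1}^{\omega'_1}\cdots x_{t'_l}^{\omega'_l}$ for $1\le i\le r$. **Algebras.** Let $\Pi$ be a set of two-coloured partitions that contains the four mixed-coloured pair partitions. Let $C(G_N(\Pi))$, $C(X_{N,d}(\Pi))$ and $C(X_N(\Pi))$ be the universal unital $C^*$-algebras generated by elements $u_{ij}$ $(1\le i,j\le N)$, by elements $x_{ij}$ $(1\le i\le N,\ 1\le j\le d)$ and by elements $x_1,\dots,x_N$, subject to the relations $R^{Gr}_p(u)$, $R^{Sp}_p(x)$ and $R^{Sp}_p(x)$ (for one vector), respectively, for all $p\in\Pi$. (They exist, because the relations of the pair partitions bound the norms of the generators by $1$.) **Theorem.** Let $1\le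 d\le N$ and let $\Pi$ be a set of two-coloured partitions that contains the four mixed-coloured pair partitions. Then $x_{ij}\mapsto u_{ij}$ $(1\le i\le N,\ 1\le j\le d)$ defines a (unique) unital $^*$-homomorphism $C(X_{N,d}(\Pi))\to C(G_N(\Pi))$, and $x_i\mapsto u_{i1}$ $(1\le i\le N)$ defines a (unique) unital $^*$-homomorphism $C(X_N(\Pi))\to C(G_N(\Pi))$. -/

import Mathlib

noncomputable section

namespace PartitionQuantumSpace

/-! ### Two-coloured partitions and decompositions of labelings -/

/-- The two colours: `white` is the label `1`, `black` is the label `*`. -/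
inductive Colour where
  | white
  | black

/-- `a ^ 1 = a` and `a ^ * = star a`. -/
def Colour.pow {A : Type*} [Star A] : Colour → A → A
  | .white, a => a
  | .black, a => star a

/-- The other colour. -/
def Colour.flip : Colour → Colour
  | .white => .black
  | .black => .white

/-- A two-coloured partition with `k` upper points (coloured by the word `ω`) and `l` lower points
(coloured by the word `ω'`). The partition of the `k + l` points into blocks is given by the
equivalence relation of lying in the same block. -/
structure ColouredPartition where
  /-- the number of upper points -/
  k : ℕ
  /-- the number of lower points -/
  l : ℕ
  /-- the colours of the upper points -/
  ω : Fin k → Colour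
  /-- the colours of the lower points -/
  ω' : Fin l → Colour
  /-- the relation "is in the same block as" -/
  blocks : Setoid (Fin k ⊕ Fin l)

namespace ColouredPartition

variable (p : ColouredPartition)

/-- The block of an upper point. -/
def upperBlock (a : Fin p.k) : Quotient p.blocks := Quotient.mk p.blocks (Sum.inl a)

/-- The block of a lower point. -/
def lowerBlock (b : Fin p.l) : Quotient p.blocks := Quotient.mk p.blocks (Sum.inr b)

/-- The through-blocks: the blocks that contain both upper and lower points. -/
def ThroughBlock : Type :=
  {B : Quotient p.blocks // (∃ a, p.upperBlock a = B) ∧ ∃ b, p.lowerBlock b = B}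

/-- A labeling of the upper row is valid if connected upper points have equal labels. -/
def UpperValid {N : ℕ} (t : Fin p.k → Fin N) : Prop :=
  ∀ a a', p.upperBlock a = p.upperBlock a' → t a = t a'

/-- A labeling of the lower row is valid if connected lower points have equal labels. -/
def LowerValid {N : ℕ} (t' : Fin p.l → Fin N) : Prop :=
  ∀ b b', p.lowerBlock b = p.lowerBlock b' → t' b = t' b'

open Classical in
/-- The set `T_i` of the decomposition of `[N]^k`. The index `i` runs through the `N ^ tb(p)`
labelings of the through-blocks, and `T_i` consists of the valid labelings of the upper row
that label the through-blocks according to `i`. -/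
def upperT (N : ℕ) (i : p.ThroughBlock → Fin N) : Finset (Fin p.k → Fin N) :=
  Finset.univ.filter fun t =>
    p.UpperValid t ∧ ∀ (a : Fin p.k) (B : p.ThroughBlock), p.upperBlock a = B.1 → t a = i B

open Classical in
/-- The set `T'_i` of the decomposition of `[N]^l`. -/
def lowerT (N : ℕ) (i : p.ThroughBlock → Fin N) : Finset (Fin p.l → Fin N) :=
  Finset.univ.filter fun t' =>
    p.LowerValid t' ∧ ∀ (b : Fin p.l) (B : p.ThroughBlock), p.lowerBlock b = B.1 → t' b = i B

theorem mem_upperT {N : ℕ} {i : p.ThroughBlock → Fin N} {t : Fin p.k → Fin N} :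
    t ∈ p.upperT N i ↔ p.UpperValid t ∧
      ∀ (a : Fin p.k) (B : p.ThroughBlock), p.upperBlock a = B.1 → t a = i B := by
  simp [upperT]

theorem mem_lowerT {N : ℕ} {i : p.ThroughBlock → Fin N} {t' : Fin p.l → Fin N} :
    t' ∈ p.lowerT N i ↔ p.LowerValid t' ∧
      ∀ (b : Fin p.l) (B : p.ThroughBlock), p.lowerBlock b = B.1 → t' b = i B := by
  simp [lowerT]

/-- The partition with no upper and two lower points, connected, with the given colours. -/
def lowerPair (c c' : Colour) : ColouredPartition where
  k := 0
  l := 2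
  ω := ![]
  ω' := ![c, c']
  blocks := ⊤

/-- The partition with two upper and no lower points, connected, with the given colours. -/
def upperPair (c c' : Colour) : ColouredPartition where
  k := 2
  l := 0
  ω := ![c, c']
  ω' := ![]
  blocks := ⊤

/-- The four mixed-coloured pair partitions. -/
def mixedPairs : Set ColouredPartition :=
  {lowerPair .white .black, lowerPair .black .white,
    upperPair .white .black, upperPair .black .white}

end ColouredPartition

/-! ### The relations associated with a partition -/

section Relations

variable {A : Type*} [Ring A] [StarRing A]

/-- The product `y_1 ^ ω_1 ⋯ y_n ^ ω_n`, which is `1` for `n = 0`. -/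
def word {n : ℕ} (ω : Fin n → Colour) (y : Fin n → A) : A :=
  (List.ofFn fun m => (ω m).pow (y m)).prod

/-- The quantum group relations of `p` for an `N × N` matrix `u`: `GroupRel p u a b` says that
`a = b` is one of them. -/
inductive GroupRel (p : ColouredPartition) {N : ℕ} (u : Fin N → Fin N → A) : A → A → Prop
  | through (i j : p.ThroughBlock → Fin N) (γ : Fin p.k → Fin N) (γ' : Fin p.l → Fin N)
      (hγ : γ ∈ p.upperT N j) (hγ' : γ' ∈ p.lowerT N i) :
      GroupRel p u
        (∑ t ∈ p.upperT N i, word p.ω fun m => u (t m) (γ m))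
        (∑ t' ∈ p.lowerT N j, word p.ω' fun m => u (γ' m) (t' m))
  | upper (i : p.ThroughBlock → Fin N) (γ : Fin p.k → Fin N) (hγ : ¬ p.UpperValid γ) :
      GroupRel p u (∑ t ∈ p.upperT N i, word p.ω fun m => u (t m) (γ m)) 0
  | lower (j : p.ThroughBlock → Fin N) (γ' : Fin p.l → Fin N) (hγ' : ¬ p.LowerValid γ') :
      GroupRel p u (∑ t' ∈ p.lowerT N j, word p.ω' fun m => u (γ' m) (t' m)) 0

/-- The quantum space relations of `p` for a `d`-tuple `x` of vectors of length `N`, where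
`d ≤ N`: `SpaceRel p h x a b` says that `a = b` is one of them. Labelings with values in `[d]`
are regarded as labelings with values in `[N]` through `Fin.castLE h`. -/
inductive SpaceRel (p : ColouredPartition) {N d : ℕ} (h : d ≤ N) (x : Fin N → Fin d → A) :
    A → A → Prop
  | through (i j : p.ThroughBlock → Fin N) (γ : Fin p.k → Fin d) (γ' : Fin p.l → Fin d)
      (hγ : (fun m => Fin.castLE h (γ m)) ∈ p.upperT N j)
      (hγ' : (fun m => Fin.castLE h (γ' m)) ∈ p.lowerT N j) :
      SpaceRel p h x
        (∑ t ∈ p.upperT N i, word p.ω fun m => x (t m) (γ m))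
        (∑ t' ∈ p.lowerT N i, word p.ω' fun m => x (t' m) (γ' m))
  | upper (i : p.ThroughBlock → Fin N) (γ : Fin p.k → Fin d)
      (hγ : ¬ p.UpperValid fun m => Fin.castLE h (γ m)) :
      SpaceRel p h x (∑ t ∈ p.upperT N i, word p.ω fun m => x (t m) (γ m)) 0
  | lower (i : p.ThroughBlock → Fin N) (γ' : Fin p.l → Fin d)
      (hγ' : ¬ p.LowerValid fun m => Fin.castLE h (γ' m)) :
      SpaceRel p h x (∑ t' ∈ p.lowerT N i, word p.ω' fun m => x (t' m) (γ' m)) 0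

/-- The quantum space relations of `p` for one vector `x` of length `N`. -/
inductive VectorRel (p : ColouredPartition) {N : ℕ} (x : Fin N → A) : A → A → Prop
  | through (i : p.ThroughBlock → Fin N) :
      VectorRel p x
        (∑ t ∈ p.upperT N i, word p.ω fun m => x (t m))
        (∑ t' ∈ p.lowerT N i, word p.ω' fun m => x (t' m))

end Relations

/-! ### C⋆-seminorms and their completions -/

/-- A C⋆-seminorm on a unital complex ⋆-algebra. -/
structure CStarSeminorm (A : Type*) [Ring A] [StarRing A] [Algebra ℂ A]
    extends Seminorm ℂ A where
  mul_le' : ∀ a b, toFun (a * b) ≤ toFun a * toFun b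
  star_mul_self' : ∀ a, toFun (star a * a) = toFun a ^ 2

namespace CStarSeminorm

section Basic

variable {A : Type*} [Ring A] [StarRing A] [Algebra ℂ A]

instance : CoeFun (CStarSeminorm A) fun _ => A → ℝ := ⟨fun p => p.toFun⟩

theorem nonneg (p : CStarSeminorm A) (a : A) : 0 ≤ p a := apply_nonneg p.toSeminorm a

theorem add_le (p : CStarSeminorm A) (a b : A) : p (a + b) ≤ p a + p b := p.add_le' a b

theorem smul_eq (p : CStarSeminorm A) (c : ℂ) (a : A) : p (c • a) = ‖c‖ * p a := p.smul' c a

theorem le_map_star (p : CStarSeminorm A) (a : A) : p a ≤ p (star a) := by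
  have h : p a * p a ≤ p (star a) * p a := by
    rw [← sq, ← p.star_mul_self' a]
    exact p.mul_le' _ _
  rcases (p.nonneg a).eq_or_lt with h0 | h0
  · rw [← h0]
    exact p.nonneg _
  · exact le_of_mul_le_mul_right h h0

theorem map_star (p : CStarSeminorm A) (a : A) : p (star a) = p a :=
  le_antisymm (by simpa using p.le_map_star (star a)) (p.le_map_star a)

theorem map_one_le (p : CStarSeminorm A) : p 1 ≤ 1 := by
  have h := p.star_mul_self' 1
  rw [star_one, one_mul] at h
  nlinarith [p.nonneg 1]

/-- The zero seminorm. -/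
instance : Zero (CStarSeminorm A) :=
  ⟨{ (0 : Seminorm ℂ A) with
      mul_le' := fun _ _ => (mul_zero (0 : ℝ)).ge
      star_mul_self' := fun _ => (zero_pow (M₀ := ℝ) two_ne_zero).symm }⟩

end Basic

section Completion

variable {A : Type*} [Ring A] [StarRing A] [Algebra ℂ A] (p : CStarSeminorm A)

/-- The algebra `A`, seminormed by `p`. -/
def Carrier (_p : CStarSeminorm A) : Type _ := A

/-- The identity map. -/
def toCarrier (a : A) : p.Carrier := a

instance : SeminormedRing p.Carrier where
  __ := (inferInstance : Ring A)
  __ := p.toSeminorm.toAddGroupSeminorm.toSeminormedAddCommGroup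
  norm_mul_le := p.mul_le'

instance : StarRing p.Carrier := inferInstanceAs (StarRing A)

instance : NormedAlgebra ℂ p.Carrier where
  __ := (inferInstance : Algebra ℂ A)
  norm_smul_le c a := (p.smul_eq c a).le

instance [StarModule ℂ A] : StarModule ℂ p.Carrier := inferInstanceAs (StarModule ℂ A)

instance : NormedStarGroup p.Carrier where
  norm_star_le a := (p.map_star a).le

/-- The separated completion of `A` with respect to `p`. -/
abbrev Completion : Type _ := UniformSpace.Completion p.Carrier

instance : NormedAlgebra ℂ p.Completion where
  norm_smul_le := norm_smul_le

/-- The canonical map from `A` to its completion. -/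
def of (a : A) : p.Completion := ((p.toCarrier a : p.Carrier) : UniformSpace.Completion p.Carrier)

theorem uniformContinuous_star_carrier : UniformContinuous (star : p.Carrier → p.Carrier) :=
  star_isometry.uniformContinuous

/-- The involution of the completion is the continuous extension of the involution of `A`. -/
instance : Star p.Completion := ⟨UniformSpace.Completion.map (star : p.Carrier → p.Carrier)⟩

theorem continuous_star_completion : Continuous (star : p.Completion → p.Completion) :=
  UniformSpace.Completion.continuous_map

theorem star_of (a : A) : star (p.of a) = p.of (star a) :=
  UniformSpace.Completion.map_coe p.uniformContinuous_star_carrier _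

theorem of_mul (a b : A) : p.of (a * b) = p.of a * p.of b :=
  UniformSpace.Completion.coe_mul (α := p.Carrier) a b

theorem of_add (a b : A) : p.of (a + b) = p.of a + p.of b :=
  UniformSpace.Completion.coe_add (α := p.Carrier) a b

theorem of_one : p.of 1 = 1 := rfl

theorem of_smul (c : ℂ) (a : A) : p.of (c • a) = c • p.of a :=
  UniformSpace.Completion.coe_smul (X := p.Carrier) c a

theorem norm_of (a : A) : ‖p.of a‖ = p a := UniformSpace.Completion.norm_coe (E := p.Carrier) a

theorem completion_induction {P : p.Completion → Prop} (a : p.Completion)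
    (hc : IsClosed {a | P a}) (h : ∀ a : A, P (p.of a)) : P a :=
  UniformSpace.Completion.induction_on a hc h

theorem completion_induction₂ {P : p.Completion → p.Completion → Prop} (a b : p.Completion)
    (hc : IsClosed {z : p.Completion × p.Completion | P z.1 z.2})
    (h : ∀ a b : A, P (p.of a) (p.of b)) : P a b :=
  UniformSpace.Completion.induction_on₂ a b hc h

instance : StarRing p.Completion where
  star_involutive a := by
    refine p.completion_induction a (P := fun a => star (star a) = a)
      (isClosed_eq ?_ continuous_id) fun a => ?_
    · exact p.continuous_star_completion.comp p.continuous_star_completion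
    · rw [star_of, star_of, star_star]
  star_mul a b := by
    refine p.completion_induction₂ a b
      (P := fun a b => star (a * b) = star b * star a)
      (isClosed_eq ?_ ?_) fun a b => ?_
    · exact p.continuous_star_completion.comp continuous_mul
    · exact (p.continuous_star_completion.comp continuous_snd).mul
        (p.continuous_star_completion.comp continuous_fst)
    · rw [← of_mul, star_of, star_of, star_of, ← of_mul, star_mul]
  star_add a b := by
    refine p.completion_induction₂ a b
      (P := fun a b => star (a + b) = star a + star b)
      (isClosed_eq ?_ ?_) fun a b => ?_
    · exact p.continuous_star_completion.comp continuous_add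
    · exact (p.continuous_star_completion.comp continuous_fst).add
        (p.continuous_star_completion.comp continuous_snd)
    · rw [← of_add, star_of, star_of, star_of, ← of_add, star_add]

instance : CStarRing p.Completion where
  norm_mul_self_le a := by
    refine p.completion_induction a (P := fun a => ‖a‖ * ‖a‖ ≤ ‖star a * a‖)
      (isClosed_le ?_ ?_) fun a => ?_
    · fun_prop
    · exact (p.continuous_star_completion.mul continuous_id).norm
    · rw [star_of, ← of_mul, norm_of, norm_of, p.star_mul_self', sq]

instance [StarModule ℂ A] : StarModule ℂ p.Completion where
  star_smul c a := by
    refine p.completion_induction a (P := fun a => star (c • a) = star c • star a)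
      (isClosed_eq ?_ ?_) fun a => ?_
    · exact p.continuous_star_completion.comp (continuous_const_smul c)
    · exact p.continuous_star_completion.const_smul (star c)
    · rw [← of_smul, star_of, star_of, ← of_smul, star_smul]

instance [StarModule ℂ A] : CStarAlgebra p.Completion where

/-- If `∑ a_i a_i⋆ = 1` modulo `p`, then `p a_i ≤ 1`. -/
theorem le_one_of_sum_eq_one [StarModule ℂ A] {n : ℕ} (a : Fin n → A)
    (h : p ((1 : A) - ∑ i, a i * star (a i)) = 0) (i : Fin n) : p (a i) ≤ 1 := by
  let f : A →+ p.Completion := ⟨⟨p.of, rfl⟩, p.of_add⟩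
  have h1 : (1 : p.Completion) = ∑ i, p.of (a i) * star (p.of (a i)) := by
    have h2 : f (1 - ∑ i, a i * star (a i)) = 0 := by
      rw [← norm_eq_zero]
      exact (p.norm_of _).trans h
    rw [map_sub, map_sum, sub_eq_zero] at h2
    refine Eq.trans ?_ (h2.trans (Finset.sum_congr rfl fun i _ => ?_))
    · exact p.of_one.symm
    · rw [star_of, ← of_mul]
      rfl
  let _ := CStarAlgebra.spectralOrder p.Completion
  let _ := CStarAlgebra.spectralOrderedRing p.Completion
  have h3 : p.of (a i) * star (p.of (a i)) ≤ 1 := by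
    rw [h1]
    exact Finset.single_le_sum (f := fun i => p.of (a i) * star (p.of (a i)))
      (fun j _ => mul_star_self_nonneg _) (Finset.mem_univ i)
  have h4 : ‖p.of (a i) * star (p.of (a i))‖ ≤ 1 :=
    CStarAlgebra.norm_le_one_iff_of_nonneg _ (mul_star_self_nonneg _) |>.2 h3
  rw [CStarRing.norm_self_mul_star, norm_of] at h4
  nlinarith [p.nonneg (a i)]

end Completion

end CStarSeminorm

/-! ### Universal C⋆-algebras -/

/-- The free unital complex ⋆-algebra on `ι`: the noncommutative polynomials in the letters
`(i, white)`, standing for the generator `i`, and `(i, black)`, standing for its adjoint. -/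
abbrev FreeStarAlgebra (ι : Type*) : Type _ := MonoidAlgebra ℂ (FreeMonoid (ι × Colour))

namespace FreeStarAlgebra

variable {ι : Type*}

/-- The generators. -/
def gen (i : ι) : FreeStarAlgebra ι := MonoidAlgebra.single (FreeMonoid.of (i, .white)) 1

/-- The adjoint of a word: reverse the order of the letters and flip their colours. -/
def wordStar (w : FreeMonoid (ι × Colour)) : FreeMonoid (ι × Colour) :=
  (FreeMonoid.map (fun s => (s.1, s.2.flip)) w).reverse

theorem wordStar_wordStar (w : FreeMonoid (ι × Colour)) : wordStar (wordStar w) = w := by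
  have h : (fun s : ι × Colour => (s.1, s.2.flip)) ∘ (fun s => (s.1, s.2.flip)) = id := by
    funext s
    rcases s with ⟨i, c⟩
    cases c <;> rfl
  have key : ∀ v : List (ι × Colour), (List.map (fun s => (s.1, s.2.flip))
      (List.map (fun s => (s.1, s.2.flip)) v).reverse).reverse = v := fun v => by
    rw [List.map_reverse, List.reverse_reverse, List.map_map, h, List.map_id]
  exact key w

theorem wordStar_mul (v w : FreeMonoid (ι × Colour)) :
    wordStar (v * w) = wordStar w * wordStar v := by
  simp [wordStar, FreeMonoid.reverse_mul]

/-- The adjoint: conjugate-linear, and `wordStar` on words. -/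
def starHom : FreeStarAlgebra ι →+ FreeStarAlgebra ι where
  toFun f := f.coeff.sum fun w c => MonoidAlgebra.single (wordStar w) (star c)
  map_zero' := by simp
  map_add' f g := by
    rw [MonoidAlgebra.coeff_add]
    exact Finsupp.sum_add_index' (by simp) (by simp)

theorem starHom_single (w : FreeMonoid (ι × Colour)) (c : ℂ) :
    starHom (MonoidAlgebra.single w c) = MonoidAlgebra.single (wordStar w) (star c) := by
  simp [starHom]

instance : StarRing (FreeStarAlgebra ι) where
  star := starHom
  star_involutive f := by
    induction f using MonoidAlgebra.induction_linear with
    | zero => simp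
    | add f g hf hg => rw [map_add, map_add, hf, hg]
    | single w c => rw [starHom_single, starHom_single, wordStar_wordStar, star_star]
  star_mul f g := by
    induction f using MonoidAlgebra.induction_linear with
    | zero => simp
    | add f₁ f₂ h₁ h₂ => rw [add_mul, map_add, map_add, mul_add, h₁, h₂]
    | single v b =>
      induction g using MonoidAlgebra.induction_linear with
      | zero => simp
      | add g₁ g₂ h₁ h₂ => rw [mul_add, map_add, map_add, add_mul, h₁, h₂]
      | single w c =>
        rw [MonoidAlgebra.single_mul_single, starHom_single, starHom_single, starHom_single,
          MonoidAlgebra.single_mul_single, wordStar_mul, star_mul]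
  star_add := starHom.map_add

instance : StarModule ℂ (FreeStarAlgebra ι) where
  star_smul c f := by
    change starHom (c • f) = star c • starHom f
    induction f using MonoidAlgebra.induction_linear with
    | zero => simp
    | add f g hf hg => rw [smul_add, map_add, map_add, smul_add, hf, hg]
    | single w b => simp [starHom_single]

end FreeStarAlgebra

/-- The C⋆-seminorms on the free ⋆-algebra in which the relations `R` hold. -/
def AdmissibleSeminorm {ι : Type*} (R : FreeStarAlgebra ι → FreeStarAlgebra ι → Prop) : Type _ :=
  {p : CStarSeminorm (FreeStarAlgebra ι) // ∀ a b, R a b → p (a - b) = 0}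

/-- The condition for the universal C⋆-algebra to exist: the relations `R` bound the norms
of the generators. -/
def BoundedRelations {ι : Type*} (R : FreeStarAlgebra ι → FreeStarAlgebra ι → Prop) : Prop :=
  ∀ i, ∃ C : ℝ, ∀ p : AdmissibleSeminorm R, p.1 (FreeStarAlgebra.gen i) ≤ C

section Universal

variable {ι : Type*} {R : FreeStarAlgebra ι → FreeStarAlgebra ι → Prop}

instance : Nonempty (AdmissibleSeminorm R) := ⟨⟨0, fun _ _ _ => rfl⟩⟩

theorem BoundedRelations.exists_bound (hR : BoundedRelations R) (a : FreeStarAlgebra ι) :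
    ∃ C : ℝ, ∀ p : AdmissibleSeminorm R, p.1 a ≤ C := by
  have hw : ∀ w : FreeMonoid (ι × Colour),
      ∃ C : ℝ, ∀ p : AdmissibleSeminorm R, p.1 (MonoidAlgebra.single w 1) ≤ C := by
    intro w
    induction w using FreeMonoid.inductionOn with
    | one => exact ⟨1, fun p => p.1.map_one_le⟩
    | of s =>
      obtain ⟨i, c⟩ := s
      obtain ⟨C, hC⟩ := hR i
      refine ⟨C, fun p => ?_⟩
      cases c with
      | white => exact hC p
      | black =>
        have h : (MonoidAlgebra.single (FreeMonoid.of (i, Colour.black)) 1 : FreeStarAlgebra ι)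
            = star (FreeStarAlgebra.gen i) := by
          change _ = FreeStarAlgebra.starHom _
          rw [FreeStarAlgebra.gen, FreeStarAlgebra.starHom_single, star_one]
          rfl
        rw [h, p.1.map_star]
        exact hC p
    | mul v w hv hw =>
      obtain ⟨C, hC⟩ := hv
      obtain ⟨D, hD⟩ := hw
      refine ⟨C * D, fun p => ?_⟩
      have h : (MonoidAlgebra.single (v * w) 1 : FreeStarAlgebra ι)
          = MonoidAlgebra.single v 1 * MonoidAlgebra.single w 1 := by
        rw [MonoidAlgebra.single_mul_single, one_mul]
      rw [h]
      exact (p.1.mul_le' _ _).trans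
        (mul_le_mul (hC p) (hD p) (p.1.nonneg _) ((p.1.nonneg _).trans (hC p)))
  induction a using MonoidAlgebra.induction_linear with
  | zero => exact ⟨0, fun p => (map_zero p.1.toSeminorm).le⟩
  | add f g hf hg =>
    obtain ⟨C, hC⟩ := hf
    obtain ⟨D, hD⟩ := hg
    exact ⟨C + D, fun p => (p.1.add_le f g).trans (add_le_add (hC p) (hD p))⟩
  | single w c =>
    obtain ⟨C, hC⟩ := hw w
    refine ⟨‖c‖ * C, fun p => ?_⟩
    have h : (MonoidAlgebra.single w c : FreeStarAlgebra ι) = c • MonoidAlgebra.single w 1 := by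
      simp
    rw [h, p.1.smul_eq]
    exact mul_le_mul_of_nonneg_left (hC p) (norm_nonneg c)

theorem BoundedRelations.bddAbove (hR : BoundedRelations R) (a : FreeStarAlgebra ι) :
    BddAbove (Set.range fun p : AdmissibleSeminorm R => p.1 a) := by
  obtain ⟨C, hC⟩ := hR.exists_bound a
  exact ⟨C, by rintro _ ⟨p, rfl⟩; exact hC p⟩

theorem BoundedRelations.le_iSup (hR : BoundedRelations R) (p : AdmissibleSeminorm R)
    (a : FreeStarAlgebra ι) : p.1 a ≤ ⨆ q : AdmissibleSeminorm R, q.1 a :=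
  le_ciSup (hR.bddAbove a) p

theorem iSup_admissible_nonneg (a : FreeStarAlgebra ι) :
    0 ≤ ⨆ q : AdmissibleSeminorm R, q.1 a :=
  Real.iSup_nonneg fun p => p.1.nonneg a

/-- The universal C⋆-seminorm: the supremum of all C⋆-seminorms in which the relations hold. -/
def universalSeminorm (hR : BoundedRelations R) : CStarSeminorm (FreeStarAlgebra ι) where
  toFun a := ⨆ p : AdmissibleSeminorm R, p.1 a
  map_zero' := by
    have h : ∀ p : AdmissibleSeminorm R, p.1 0 = 0 := fun p => map_zero p.1.toSeminorm
    simp [h]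
  add_le' a b := ciSup_le fun p =>
    (p.1.add_le a b).trans (add_le_add (hR.le_iSup p a) (hR.le_iSup p b))
  neg' a := by
    have h : ∀ p : AdmissibleSeminorm R, p.1 (-a) = p.1 a := fun p => map_neg_eq_map p.1.toSeminorm a
    simp [h]
  smul' c a := by
    have h : ∀ p : AdmissibleSeminorm R, p.1 (c • a) = ‖c‖ * p.1 a := fun p => p.1.smul_eq c a
    simp only [h]
    exact (Real.mul_iSup_of_nonneg (norm_nonneg c) _).symm
  mul_le' a b := ciSup_le fun p => (p.1.mul_le' a b).trans
    (mul_le_mul (hR.le_iSup p a) (hR.le_iSup p b) (p.1.nonneg b) (iSup_admissible_nonneg a))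
  star_mul_self' a := by
    have h : ∀ p : AdmissibleSeminorm R, p.1 (star a * a) = p.1 a ^ 2 :=
      fun p => p.1.star_mul_self' a
    refine le_antisymm (ciSup_le fun p => ?_) ?_
    · rw [h]
      exact pow_le_pow_left₀ (p.1.nonneg a) (hR.le_iSup p a) 2
    · rw [← Real.le_sqrt (iSup_admissible_nonneg a) (iSup_admissible_nonneg _)]
      refine ciSup_le fun p => Real.le_sqrt_of_sq_le ?_
      rw [← h]
      exact hR.le_iSup p (star a * a)

/-- The universal unital C⋆-algebra `C⋆(ι | R)` with generators `ι` and relations `R`: the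
separated completion of the free ⋆-algebra with respect to the universal C⋆-seminorm. -/
abbrev UniversalCStarAlgebra (hR : BoundedRelations R) : Type _ :=
  (universalSeminorm hR).Completion

/-- The generators of the universal C⋆-algebra. -/
def UniversalCStarAlgebra.gen (hR : BoundedRelations R) (i : ι) : UniversalCStarAlgebra hR :=
  (universalSeminorm hR).of (FreeStarAlgebra.gen i)

end Universal

/-! ### Easy quantum groups and partition quantum spaces -/

section Objects

open ColouredPartition

/-- The relations of the easy quantum group `G_N(P)`, for the generators `u_ij`. -/
def easyRelations (N : ℕ) (P : Set ColouredPartition) :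
    FreeStarAlgebra (Fin N × Fin N) → FreeStarAlgebra (Fin N × Fin N) → Prop :=
  fun a b => ∃ p ∈ P, GroupRel p (fun i j => FreeStarAlgebra.gen (i, j)) a b

/-- The relations of the partition quantum space `X_{N,d}(P)`, for the generators `x_ij`. -/
def spaceRelations (N d : ℕ) (hdN : d ≤ N) (P : Set ColouredPartition) :
    FreeStarAlgebra (Fin N × Fin d) → FreeStarAlgebra (Fin N × Fin d) → Prop :=
  fun a b => ∃ p ∈ P, SpaceRel p hdN (fun i j => FreeStarAlgebra.gen (i, j)) a b

/-- The relations of the partition quantum space `X_N(P)` of one vector, for the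
generators `x_i`. -/
def vectorRelations (N : ℕ) (P : Set ColouredPartition) :
    FreeStarAlgebra (Fin N) → FreeStarAlgebra (Fin N) → Prop :=
  fun a b => ∃ p ∈ P, VectorRel p FreeStarAlgebra.gen a b

instance (c c' : Colour) : IsEmpty (lowerPair c c').ThroughBlock :=
  ⟨fun B => B.2.1.choose.elim0⟩

theorem mem_upperT_lowerPair (c c' : Colour) {N : ℕ}
    (i : (lowerPair c c').ThroughBlock → Fin N) (t : Fin (lowerPair c c').k → Fin N) :
    t ∈ (lowerPair c c').upperT N i := by
  rw [mem_upperT]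
  exact ⟨fun a => Fin.elim0 a, fun a => Fin.elim0 a⟩

theorem sum_upperT_lowerPair {A : Type*} [Ring A] [StarRing A] (c c' : Colour) {N : ℕ}
    (i : (lowerPair c c').ThroughBlock → Fin N)
    (y : (Fin (lowerPair c c').k → Fin N) → Fin (lowerPair c c').k → A) :
    ∑ t ∈ (lowerPair c c').upperT N i, word (lowerPair c c').ω (y t) = 1 := by
  refine (Finset.sum_eq_single_of_mem (fun a => Fin.elim0 a) (mem_upperT_lowerPair c c' i _)
    fun t _ ht => (ht (funext fun a => Fin.elim0 a)).elim).trans ?_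
  rfl

theorem mem_lowerT_lowerPair (c c' : Colour) {N : ℕ}
    (i : (lowerPair c c').ThroughBlock → Fin N) (t : Fin (lowerPair c c').l → Fin N) :
    t ∈ (lowerPair c c').lowerT N i ↔ t (0 : Fin 2) = t (1 : Fin 2) := by
  rw [mem_lowerT]
  constructor
  · rintro ⟨h, -⟩
    exact h (0 : Fin 2) (1 : Fin 2) (Quotient.sound trivial)
  · intro h
    refine ⟨fun b b' _ => ?_, fun _ B => isEmptyElim B⟩
    have key : ∀ (t : Fin 2 → Fin N), t 0 = t 1 → ∀ b b' : Fin 2, t b = t b' := by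
      intro t h b b'
      fin_cases b <;> fin_cases b' <;> simp [h]
    exact key t h b b'

theorem sum_lowerT_lowerPair {A : Type*} [Ring A] [StarRing A] {N : ℕ}
    (i : (lowerPair .white .black).ThroughBlock → Fin N) (y : Fin N → A) :
    ∑ t ∈ (lowerPair .white .black).lowerT N i,
      word (lowerPair .white .black).ω' (fun m => y (t m)) = ∑ s, y s * star (y s) := by
  symm
  refine Finset.sum_bij (fun s _ => (fun _ => s : Fin 2 → Fin N)) ?_ ?_ ?_ ?_
  · intro s _
    exact (mem_lowerT_lowerPair _ _ i _).2 rfl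
  · intro s _ s' _ h
    exact congrFun h (0 : Fin 2)
  · intro t ht
    have h := (mem_lowerT_lowerPair _ _ i t).1 ht
    refine ⟨t (0 : Fin 2), Finset.mem_univ _, funext fun m => ?_⟩
    have key : ∀ (t : Fin 2 → Fin N), t 0 = t 1 → ∀ m : Fin 2, t 0 = t m := by
      intro t h m
      fin_cases m <;> simp [h]
    exact key t h m
  · intro s _
    change _ = (List.ofFn fun m : Fin 2 => (![Colour.white, Colour.black] m).pow (y s)).prod
    simp [Colour.pow]

theorem boundedRelations_of_sum {ι : Type*}
    {R : FreeStarAlgebra ι → FreeStarAlgebra ι → Prop}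
    (h : ∀ i, ∃ (N : ℕ) (y : Fin N → FreeStarAlgebra ι) (s : Fin N),
      y s = FreeStarAlgebra.gen i ∧ R 1 (∑ s, y s * star (y s))) : BoundedRelations R := by
  intro i
  obtain ⟨N, y, s, hs, hR⟩ := h i
  exact ⟨1, fun p => hs ▸ p.1.le_one_of_sum_eq_one y (p.2 _ _ hR) s⟩

theorem easyRelations_bounded (N : ℕ) {P : Set ColouredPartition} (hP : mixedPairs ⊆ P) :
    BoundedRelations (easyRelations N P) := by
  refine boundedRelations_of_sum fun ⟨i, j⟩ =>
    ⟨N, fun s => FreeStarAlgebra.gen (i, s), j, rfl, lowerPair .white .black,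
      hP (by simp [mixedPairs]), ?_⟩
  have h := GroupRel.through (p := lowerPair .white .black)
    (u := fun i j : Fin N => FreeStarAlgebra.gen (i, j)) isEmptyElim isEmptyElim
    (fun a => Fin.elim0 a) (fun _ => i) ?_ ((mem_lowerT_lowerPair _ _ _ _).2 rfl)
  · rwa [sum_upperT_lowerPair, sum_lowerT_lowerPair _ fun s => FreeStarAlgebra.gen (i, s)] at h
  · exact mem_upperT_lowerPair _ _ _ _

theorem spaceRelations_bounded (N d : ℕ) (hdN : d ≤ N) {P : Set ColouredPartition}
    (hP : mixedPairs ⊆ P) : BoundedRelations (spaceRelations N d hdN P) := by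
  refine boundedRelations_of_sum fun ⟨i, j⟩ =>
    ⟨N, fun s => FreeStarAlgebra.gen (s, j), i, rfl, lowerPair .white .black,
      hP (by simp [mixedPairs]), ?_⟩
  have h := SpaceRel.through (p := lowerPair .white .black) (h := hdN)
    (x := fun (i : Fin N) (j : Fin d) => FreeStarAlgebra.gen (i, j)) isEmptyElim isEmptyElim
    (fun a => Fin.elim0 a) (fun _ => j) ?_ ((mem_lowerT_lowerPair _ _ _ _).2 rfl)
  · rwa [sum_upperT_lowerPair, sum_lowerT_lowerPair _ fun s => FreeStarAlgebra.gen (s, j)] at h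
  · exact mem_upperT_lowerPair _ _ _ _

theorem vectorRelations_bounded (N : ℕ) {P : Set ColouredPartition} (hP : mixedPairs ⊆ P) :
    BoundedRelations (vectorRelations N P) := by
  refine boundedRelations_of_sum fun i =>
    ⟨N, FreeStarAlgebra.gen, i, rfl, lowerPair .white .black, hP (by simp [mixedPairs]), ?_⟩
  have h := VectorRel.through (p := lowerPair .white .black)
    (x := (FreeStarAlgebra.gen : Fin N → _)) isEmptyElim
  rwa [sum_upperT_lowerPair, sum_lowerT_lowerPair] at h

variable (N d : ℕ) (hdN : d ≤ N) (P : Set ColouredPartition) (hP : mixedPairs ⊆ P)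

/-- The C⋆-algebra `C(G_N(P))` of the easy quantum group `G_N(P)`. -/
abbrev EasyQuantumGroup : Type := UniversalCStarAlgebra (easyRelations_bounded N hP)

/-- The matrix of generators of `C(G_N(P))`. -/
def EasyQuantumGroup.u (i j : Fin N) : EasyQuantumGroup N P hP :=
  UniversalCStarAlgebra.gen (easyRelations_bounded N hP) (i, j)

/-- The C⋆-algebra `C(X_{N,d}(P))` of the partition quantum space of `d` vectors. -/
abbrev PartitionSpace : Type := UniversalCStarAlgebra (spaceRelations_bounded N d hdN hP)

/-- The generators of `C(X_{N,d}(P))`. -/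
def PartitionSpace.x (i : Fin N) (j : Fin d) : PartitionSpace N d hdN P hP :=
  UniversalCStarAlgebra.gen (spaceRelations_bounded N d hdN hP) (i, j)

/-- The C⋆-algebra `C(X_N(P))` of the partition quantum space of one vector. -/
abbrev OneVectorSpace : Type := UniversalCStarAlgebra (vectorRelations_bounded N hP)

/-- The generators of `C(X_N(P))`. -/
def OneVectorSpace.x (i : Fin N) : OneVectorSpace N P hP :=
  UniversalCStarAlgebra.gen (vectorRelations_bounded N hP) i

end Objects

end PartitionQuantumSpace

end

/-!
Let `u` satisfy the quantum group relations of `P`. The relations of the four mixed-coloured pair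
partitions say that `u` and its entrywise adjoint are unitary, hence so is every tensor power
`u ^ ω`. The relations of `p` say that the `0`-`1` matrix `T` of `p` intertwines the tensor
powers, `T u ^ ω = u ^ ω' T`, and taking adjoints and multiplying by the unitaries on both sides
yields `u ^ ω Tᵀ = Tᵀ u ^ ω'`. For `γ ∈ T_j` the first identity makes the column sum
`∑ t ∈ T_i, u_{tγ} ^ ω` independent of `γ`. For `δ ∈ T_i` the second one identifies the row sum
`∑ t ∈ T_j, u_{δt} ^ ω` with the lower side `∑ t' ∈ T'_i, u_{t'γ'} ^ ω'` of the quantum space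
relation. As `T_i` and `T_j` have the same size, summing over the whole square `T_i × T_j` shows
that the constant column sum and the constant row sum agree.
-/

namespace PartitionQuantumSpace

open ColouredPartition
open scoped Matrix

/-! ### Square arrays and tensor products of matrices -/

section SumsAndMatrices

theorem colSum_eq_rowSum_of_card_eq {α β M : Type*} [AddCommMonoid M] [IsAddTorsionFree M]
    {S : Finset α} {R : Finset β} (hcard : S.card = R.card) (hS : S.Nonempty) {f : α → β → M}
    {c d : M} (hcol : ∀ r ∈ R, ∑ s ∈ S, f s r = c) (hrow : ∀ s ∈ S, ∑ r ∈ R, f s r = d) :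
    c = d := by
  have htotal : S.card • c = S.card • d := calc
    S.card • c = ∑ r ∈ R, ∑ s ∈ S, f s r := by
      rw [hcard, ← Finset.sum_const, Finset.sum_congr rfl hcol]
    _ = ∑ s ∈ S, ∑ r ∈ R, f s r := Finset.sum_comm
    _ = S.card • d := by rw [← Finset.sum_const, Finset.sum_congr rfl hrow]
  exact nsmul_right_injective hS.card_pos.ne' htotal

theorem sum_pi_fin_succ {n : ℕ} {α : Fin (n + 1) → Type*} [∀ m, Fintype (α m)] {M : Type*}
    [AddCommMonoid M] (f : (∀ m, α m) → M) :
    ∑ t, f t = ∑ a : α 0, ∑ t : ∀ m : Fin n, α m.succ, f (Fin.cons a t) := by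
  rw [← Fintype.sum_prod_type', ← (Fin.consEquiv α).sum_comp]
  rfl

theorem sum_fin_two_ite_eq {X M : Type*} [Fintype X] [DecidableEq X] [AddCommMonoid M]
    (f : (Fin 2 → X) → M) : ∑ t, (if t 0 = t 1 then f t else 0) = ∑ x, f ![x, x] := by
  rw [← (finTwoArrowEquiv X).symm.sum_comp, Fintype.sum_prod_type]
  simp

theorem one_apply_fin_succ {n : ℕ} {I A : Type*} [DecidableEq I] [MulZeroOneClass A]
    (s t : Fin (n + 1) → I) :
    (1 : Matrix (Fin (n + 1) → I) (Fin (n + 1) → I) A) s t =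
      (1 : Matrix I I A) (s 0) (t 0) *
        (1 : Matrix (Fin n → I) (Fin n → I) A) (Fin.tail s) (Fin.tail t) := by
  have heq : s = t ↔ s 0 = t 0 ∧ Fin.tail s = Fin.tail t := by
    simp only [funext_iff, Fin.forall_fin_succ, Fin.tail]
  by_cases h : s 0 = t 0 <;> simp [Matrix.one_apply, heq, h]

/-- The tensor product of the matrices `U 0, …, U (n - 1)`, with the entries multiplied in this
order. `Matrix.kronecker` is not used because `A` need not be commutative. -/
def tensorProduct {n : ℕ} {I J A : Type*} [Monoid A] (U : Fin n → Matrix I J A) :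
    Matrix (Fin n → I) (Fin n → J) A :=
  .of fun s t => (List.ofFn fun m => U m (s m) (t m)).prod

theorem tensorProduct_succ {n : ℕ} {I J A : Type*} [Monoid A] (U : Fin (n + 1) → Matrix I J A)
    (s : Fin (n + 1) → I) (t : Fin (n + 1) → J) :
    tensorProduct U s t =
      U 0 (s 0) (t 0) * tensorProduct (Fin.tail U) (Fin.tail s) (Fin.tail t) := by
  simp [tensorProduct, List.ofFn_succ, Fin.tail]

theorem tensorProduct_of_isEmpty {I J A : Type*} [Monoid A] (U : Fin 0 → Matrix I J A)
    (s : Fin 0 → I) (t : Fin 0 → J) : tensorProduct U s t = 1 := rfl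

variable {n : ℕ} {I J A : Type*} [Semiring A] [StarRing A]

theorem tensorProduct_mul_conjTranspose [DecidableEq I] [Fintype J] {U : Fin n → Matrix I J A}
    (hU : ∀ m, U m * (U m)ᴴ = 1) : tensorProduct U * (tensorProduct U)ᴴ = 1 := by
  induction n with
  | zero =>
    ext s s'
    rw [Subsingleton.elim s s', Matrix.one_apply_eq]
    simp [Matrix.mul_apply, tensorProduct_of_isEmpty]
  | succ n ih =>
    ext s s'
    have htail : tensorProduct (Fin.tail U) * (tensorProduct (Fin.tail U))ᴴ = 1 :=
      ih fun m => hU m.succ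
    calc (tensorProduct U * (tensorProduct U)ᴴ) s s'
        = ∑ j, U 0 (s 0) j * (tensorProduct (Fin.tail U) * (tensorProduct (Fin.tail U))ᴴ)
            (Fin.tail s) (Fin.tail s') * star (U 0 (s' 0) j) := by
          simp only [Matrix.mul_apply, Matrix.conjTranspose_apply, sum_pi_fin_succ,
            tensorProduct_succ, Fin.cons_zero, Fin.tail_cons, star_mul, Finset.mul_sum,
            Finset.sum_mul, mul_assoc]
      _ = (U 0 * (U 0)ᴴ) (s 0) (s' 0) *
            (1 : Matrix (Fin n → I) (Fin n → I) A) (Fin.tail s) (Fin.tail s') := by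
          rw [htail, Matrix.mul_apply, Finset.sum_mul]
          by_cases h : Fin.tail s = Fin.tail s' <;> simp [Matrix.one_apply, h]
      _ = (1 : Matrix (Fin (n + 1) → I) (Fin (n + 1) → I) A) s s' := by
          rw [hU 0, ← one_apply_fin_succ]

theorem conjTranspose_mul_tensorProduct [Fintype I] [DecidableEq J] {U : Fin n → Matrix I J A}
    (hU : ∀ m, (U m)ᴴ * U m = 1) : (tensorProduct U)ᴴ * tensorProduct U = 1 := by
  induction n with
  | zero =>
    ext t t'
    rw [Subsingleton.elim t t', Matrix.one_apply_eq]
    simp [Matrix.mul_apply, tensorProduct_of_isEmpty]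
  | succ n ih =>
    ext t t'
    have htail : (tensorProduct (Fin.tail U))ᴴ * tensorProduct (Fin.tail U) = 1 :=
      ih fun m => hU m.succ
    calc ((tensorProduct U)ᴴ * tensorProduct U) t t'
        = ∑ s, star (tensorProduct (Fin.tail U) s (Fin.tail t)) * ((U 0)ᴴ * U 0) (t 0) (t' 0) *
            tensorProduct (Fin.tail U) s (Fin.tail t') := by
          simp only [Matrix.mul_apply, Matrix.conjTranspose_apply, sum_pi_fin_succ,
            tensorProduct_succ, Fin.cons_zero, Fin.tail_cons, star_mul, Finset.mul_sum,
            Finset.sum_mul, mul_assoc]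
          exact Finset.sum_comm
      _ = (1 : Matrix J J A) (t 0) (t' 0) *
            ((tensorProduct (Fin.tail U))ᴴ * tensorProduct (Fin.tail U))
              (Fin.tail t) (Fin.tail t') := by
          rw [hU 0, Matrix.mul_apply, Finset.mul_sum]
          by_cases h : t 0 = t' 0 <;> simp [Matrix.one_apply, h]
      _ = (1 : Matrix (Fin (n + 1) → J) (Fin (n + 1) → J) A) t t' := by
          rw [htail, ← one_apply_fin_succ]

theorem mul_conjTranspose_of_intertwines [Fintype I] [Fintype J] [DecidableEq I] [DecidableEq J]
    {T : Matrix J I A} {V : Matrix I I A} {W : Matrix J J A} (hV : V * Vᴴ = 1) (hW : Wᴴ * W = 1)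
    (h : T * V = W * T) : V * Tᴴ = Tᴴ * W :=
  calc V * Tᴴ = V * (W * T)ᴴ * W := by
        rw [Matrix.conjTranspose_mul, Matrix.mul_assoc, Matrix.mul_assoc, hW, Matrix.mul_one]
    _ = Tᴴ * W := by
        rw [← h, Matrix.conjTranspose_mul, ← Matrix.mul_assoc, hV, Matrix.one_mul]

end SumsAndMatrices

/-! ### Labelings and their relabelings -/

section Relabel

variable {α Q X : Type*} (β : α → Q) {S : Q → Prop}

open Classical in
/-- The labeling of the points `α` that carries the labels `j` on the blocks in `S` and the labels
`t` elsewhere, where `β a` is the block of the point `a`. -/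
noncomputable def relabel (j : Subtype S → X) (t : α → X) : α → X := fun a =>
  if h : S (β a) then j ⟨β a, h⟩ else t a

variable {β}

theorem relabel_of_mem (j : Subtype S → X) (t : α → X) {a : α} {B : Subtype S}
    (h : β a = B.1) : relabel β j t a = j B := by
  obtain ⟨B, hB⟩ := B
  subst h
  exact dif_pos hB

theorem relabel_of_notMem (j : Subtype S → X) (t : α → X) {a : α} (h : ¬ S (β a)) :
    relabel β j t a = t a :=
  dif_neg h

theorem factorsThrough_relabel (j : Subtype S → X) {t : α → X} (ht : t.FactorsThrough β) :
    (relabel β j t).FactorsThrough β := by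
  intro a a' h
  by_cases ha : S (β a)
  · rw [relabel_of_mem j t (B := ⟨β a, ha⟩) rfl, relabel_of_mem j t (B := ⟨β a, ha⟩) h.symm]
  · rw [relabel_of_notMem j t ha, relabel_of_notMem j t (h ▸ ha), ht h]

theorem relabel_relabel_of_eq {i : Subtype S → X} (j : Subtype S → X) {t : α → X}
    (ht : ∀ a (B : Subtype S), β a = B.1 → t a = i B) : relabel β i (relabel β j t) = t := by
  funext a
  by_cases ha : S (β a)
  · rw [relabel_of_mem (β := β) _ _ (B := ⟨β a, ha⟩) rfl, ht a ⟨β a, ha⟩ rfl]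
  · rw [relabel_of_notMem _ _ ha, relabel_of_notMem _ _ ha]

end Relabel

namespace ColouredPartition

variable (p : ColouredPartition) {N : ℕ}

theorem relabel_mem_upperT {t : Fin p.k → Fin N} (ht : p.UpperValid t)
    (j : p.ThroughBlock → Fin N) : relabel p.upperBlock j t ∈ p.upperT N j :=
  p.mem_upperT.2 ⟨factorsThrough_relabel j ht, fun _ _ h => relabel_of_mem j t h⟩

theorem relabel_mem_lowerT {t' : Fin p.l → Fin N} (ht' : p.LowerValid t')
    (j : p.ThroughBlock → Fin N) : relabel p.lowerBlock j t' ∈ p.lowerT N j :=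
  p.mem_lowerT.2 ⟨factorsThrough_relabel j ht', fun _ _ h => relabel_of_mem j t' h⟩

theorem card_upperT_eq (i j : p.ThroughBlock → Fin N) :
    (p.upperT N i).card = (p.upperT N j).card :=
  Finset.card_nbij' (relabel p.upperBlock j) (relabel p.upperBlock i)
    (fun _ ht => p.relabel_mem_upperT (p.mem_upperT.1 ht).1 j)
    (fun _ ht => p.relabel_mem_upperT (p.mem_upperT.1 ht).1 i)
    (fun _ ht => relabel_relabel_of_eq j (p.mem_upperT.1 ht).2)
    (fun _ ht => relabel_relabel_of_eq i (p.mem_upperT.1 ht).2)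

variable {p}

theorem UpperValid.exists_mem_upperT {t : Fin p.k → Fin N} (ht : p.UpperValid t) :
    ∃ i, t ∈ p.upperT N i :=
  ⟨fun B => t B.2.1.choose, p.mem_upperT.2
    ⟨ht, fun _ B h => ht _ _ (h.trans B.2.1.choose_spec.symm)⟩⟩

theorem LowerValid.exists_mem_lowerT {t' : Fin p.l → Fin N} (ht' : p.LowerValid t') :
    ∃ i, t' ∈ p.lowerT N i :=
  ⟨fun B => t' B.2.2.choose, p.mem_lowerT.2
    ⟨ht', fun _ B h => ht' _ _ (h.trans B.2.2.choose_spec.symm)⟩⟩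

/-- A labeling of the upper row and one of the lower row are compatible if together they are
constant on the blocks of `p`. -/
def Compatible (p : ColouredPartition) (t : Fin p.k → Fin N) (t' : Fin p.l → Fin N) : Prop :=
  (Sum.elim t t').FactorsThrough (Quotient.mk p.blocks)

theorem Compatible.upperValid {t : Fin p.k → Fin N} {t' : Fin p.l → Fin N}
    (h : p.Compatible t t') : p.UpperValid t :=
  fun a a' haa' => h (a := .inl a) (b := .inl a') haa'

theorem Compatible.lowerValid {t : Fin p.k → Fin N} {t' : Fin p.l → Fin N}
    (h : p.Compatible t t') : p.LowerValid t' :=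
  fun b b' hbb' => h (a := .inr b) (b := .inr b') hbb'

theorem compatible_of_mem {i : p.ThroughBlock → Fin N} {t : Fin p.k → Fin N}
    {t' : Fin p.l → Fin N} (ht : t ∈ p.upperT N i) (ht' : t' ∈ p.lowerT N i) :
    p.Compatible t t' := by
  obtain ⟨hv, hi⟩ := p.mem_upperT.1 ht
  obtain ⟨hv', hi'⟩ := p.mem_lowerT.1 ht'
  have hmixed (a : Fin p.k) (b : Fin p.l) (h : p.upperBlock a = p.lowerBlock b) : t a = t' b :=
    let B : p.ThroughBlock := ⟨p.upperBlock a, ⟨a, rfl⟩, ⟨b, h.symm⟩⟩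
    (hi a B rfl).trans (hi' b B h.symm).symm
  rintro (a | b) (a' | b') h
  · exact hv a a' h
  · exact hmixed a b' h
  · exact (hmixed a' b h.symm).symm
  · exact hv' b b' h

theorem compatible_iff_mem_upperT {i : p.ThroughBlock → Fin N} {t' : Fin p.l → Fin N}
    (ht' : t' ∈ p.lowerT N i) (t : Fin p.k → Fin N) : p.Compatible t t' ↔ t ∈ p.upperT N i := by
  refine ⟨fun h => p.mem_upperT.2 ⟨h.upperValid, fun a B hB => ?_⟩,
    fun ht => compatible_of_mem ht ht'⟩
  obtain ⟨b, hb⟩ := B.2.2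
  exact (h (a := .inl a) (b := .inr b) (hB.trans hb.symm)).trans ((p.mem_lowerT.1 ht').2 b B hb)

theorem compatible_iff_mem_lowerT {i : p.ThroughBlock → Fin N} {t : Fin p.k → Fin N}
    (ht : t ∈ p.upperT N i) (t' : Fin p.l → Fin N) : p.Compatible t t' ↔ t' ∈ p.lowerT N i := by
  refine ⟨fun h => p.mem_lowerT.2 ⟨h.lowerValid, fun b B hB => ?_⟩,
    fun ht' => compatible_of_mem ht ht'⟩
  obtain ⟨a, ha⟩ := B.2.1
  exact (h (a := .inr b) (b := .inl a) (hB.trans ha.symm)).trans ((p.mem_upperT.1 ht).2 a B ha)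

theorem compatible_lowerPair (c c' : Colour) (t : Fin 0 → Fin N) (t' : Fin 2 → Fin N) :
    (lowerPair c c').Compatible t t' ↔ t' 0 = t' 1 :=
  (compatible_iff_mem_lowerT (mem_upperT_lowerPair c c' isEmptyElim t) t').trans
    (mem_lowerT_lowerPair c c' isEmptyElim t')

theorem compatible_upperPair (c c' : Colour) (t : Fin 2 → Fin N) (t' : Fin 0 → Fin N) :
    (upperPair c c').Compatible t t' ↔ t 0 = t 1 := by
  refine ⟨fun h => h (a := .inl (0 : Fin 2)) (b := .inl (1 : Fin 2)) (Quotient.sound trivial),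
    fun h => ?_⟩
  have hconst : ∀ a : Fin 2, t a = t 0 := Fin.forall_fin_two.2 ⟨rfl, h.symm⟩
  rintro (a | b) (a' | b') -
  · exact (hconst a).trans (hconst a').symm
  · exact b'.elim0
  · exact b.elim0
  · exact b.elim0

end ColouredPartition

/-! ### The intertwiner of a partition -/

namespace ColouredPartition

section Intertwiner

variable {A : Type*} [Semiring A] {N : ℕ} {p : ColouredPartition}

open Classical in
/-- The `0`-`1` matrix of a partition, which describes the linear map `T_p` from the upper tensor
power of `ℂ ^ N` to the lower one; here with entries in an arbitrary semiring. -/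
noncomputable def intertwiner (A : Type*) [Semiring A] (N : ℕ) (p : ColouredPartition) :
    Matrix (Fin p.l → Fin N) (Fin p.k → Fin N) A :=
  .of fun t' t => if p.Compatible t t' then 1 else 0

theorem conjTranspose_intertwiner [StarRing A] :
    (intertwiner A N p)ᴴ = (intertwiner A N p)ᵀ := by
  ext t t'
  simp only [intertwiner, Matrix.conjTranspose_apply, Matrix.transpose_apply, Matrix.of_apply,
    apply_ite star, star_one, star_zero]

variable {J : Type*} {i : p.ThroughBlock → Fin N} {t : Fin p.k → Fin N} {t' : Fin p.l → Fin N}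

theorem intertwiner_mul_apply (ht' : t' ∈ p.lowerT N i) (M : Matrix (Fin p.k → Fin N) J A)
    (c : J) : (intertwiner A N p * M) t' c = ∑ t ∈ p.upperT N i, M t c := by
  classical
  simp [Matrix.mul_apply, intertwiner, compatible_iff_mem_upperT ht']

theorem mul_intertwiner_apply (ht : t ∈ p.upperT N i) (M : Matrix J (Fin p.l → Fin N) A)
    (c : J) : (M * intertwiner A N p) c t = ∑ t' ∈ p.lowerT N i, M c t' := by
  classical
  simp [Matrix.mul_apply, intertwiner, compatible_iff_mem_lowerT ht]

theorem transpose_intertwiner_mul_apply (ht : t ∈ p.upperT N i)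
    (M : Matrix (Fin p.l → Fin N) J A) (c : J) :
    ((intertwiner A N p)ᵀ * M) t c = ∑ t' ∈ p.lowerT N i, M t' c := by
  classical
  simp [Matrix.mul_apply, intertwiner, compatible_iff_mem_lowerT ht]

theorem mul_transpose_intertwiner_apply (ht' : t' ∈ p.lowerT N i)
    (M : Matrix J (Fin p.k → Fin N) A) (c : J) :
    (M * (intertwiner A N p)ᵀ) c t' = ∑ t ∈ p.upperT N i, M c t := by
  classical
  simp [Matrix.mul_apply, intertwiner, compatible_iff_mem_upperT ht']

theorem intertwiner_mul_apply_of_not_lowerValid (ht' : ¬ p.LowerValid t')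
    (M : Matrix (Fin p.k → Fin N) J A) (c : J) : (intertwiner A N p * M) t' c = 0 := by
  simp [Matrix.mul_apply, intertwiner, mt Compatible.lowerValid ht']

theorem mul_intertwiner_apply_of_not_upperValid (ht : ¬ p.UpperValid t)
    (M : Matrix J (Fin p.l → Fin N) A) (c : J) : (M * intertwiner A N p) c t = 0 := by
  simp [Matrix.mul_apply, intertwiner, mt Compatible.upperValid ht]

theorem mul_transpose_intertwiner_apply_of_not_lowerValid (ht' : ¬ p.LowerValid t')
    (M : Matrix J (Fin p.k → Fin N) A) (c : J) : (M * (intertwiner A N p)ᵀ) c t' = 0 := by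
  simp [Matrix.mul_apply, intertwiner, mt Compatible.lowerValid ht']

theorem intertwiner_lowerPair (c c' : Colour) : intertwiner A N (lowerPair c c') =
    (.of fun t' _ => if t' 0 = t' 1 then 1 else 0 :
      Matrix (Fin 2 → Fin N) (Fin 0 → Fin N) A) := by
  classical
  ext t' t
  exact if_congr (compatible_lowerPair c c' t t') rfl rfl

theorem intertwiner_upperPair (c c' : Colour) : intertwiner A N (upperPair c c') =
    (.of fun _ t => if t 0 = t 1 then 1 else 0 :
      Matrix (Fin 0 → Fin N) (Fin 2 → Fin N) A) := by
  classical
  ext t' t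
  exact if_congr (compatible_upperPair c c' t t') rfl rfl

end Intertwiner

end ColouredPartition

/-! ### The quantum group relations as intertwining relations -/

theorem Colour.star_pow {A : Type*} [InvolutiveStar A] (c : Colour) (a : A) :
    star (c.pow a) = c.flip.pow a := by
  cases c
  · rfl
  · exact star_star a

/-- The tensor power `u ^ ω` of a matrix `u`: the tensor product whose factors are `u` at the
letters `1` of `ω` and the entrywise adjoint of `u` at the letters `*`. -/
def tensorPower {A : Type*} [Monoid A] [Star A] {n N : ℕ} (ω : Fin n → Colour)
    (u : Fin N → Fin N → A) : Matrix (Fin n → Fin N) (Fin n → Fin N) A :=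
  tensorProduct fun m => (Matrix.of u).map (ω m).pow

section Relations

variable {A : Type*} [Ring A] [StarRing A]

/-- The matrix `u` satisfies the quantum group relations of `p`. -/
def SatisfiesGroupRel (p : ColouredPartition) {N : ℕ} (u : Fin N → Fin N → A) : Prop :=
  ∀ ⦃a b⦄, GroupRel p u a b → a = b

/-- The `d`-tuple of vectors `x` satisfies the quantum space relations of `p`. -/
def SatisfiesSpaceRel (p : ColouredPartition) {N d : ℕ} (h : d ≤ N) (x : Fin N → Fin d → A) :
    Prop :=
  ∀ ⦃a b⦄, SpaceRel p h x a b → a = b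

/-- The vector `x` satisfies the quantum space relations of `p`. -/
def SatisfiesVectorRel (p : ColouredPartition) {N : ℕ} (x : Fin N → A) : Prop :=
  ∀ ⦃a b⦄, VectorRel p x a b → a = b

variable {p : ColouredPartition} {N : ℕ} {u : Fin N → Fin N → A}

theorem SatisfiesGroupRel.intertwiner_mul_tensorPower (hu : SatisfiesGroupRel p u) :
    intertwiner A N p * tensorPower p.ω u = tensorPower p.ω' u * intertwiner A N p := by
  ext γ' γ
  by_cases hγ : p.UpperValid γ <;> by_cases hγ' : p.LowerValid γ'
  · obtain ⟨j, hγj⟩ := hγ.exists_mem_upperT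
    obtain ⟨i, hγi'⟩ := hγ'.exists_mem_lowerT
    rw [intertwiner_mul_apply hγi', mul_intertwiner_apply hγj]
    exact hu (.through i j γ γ' hγj hγi')
  · obtain ⟨j, hγj⟩ := hγ.exists_mem_upperT
    rw [intertwiner_mul_apply_of_not_lowerValid hγ', mul_intertwiner_apply hγj]
    exact (hu (.lower j γ' hγ')).symm
  · obtain ⟨i, hγi'⟩ := hγ'.exists_mem_lowerT
    rw [intertwiner_mul_apply hγi', mul_intertwiner_apply_of_not_upperValid hγ]
    exact hu (.upper i γ hγ)
  · rw [intertwiner_mul_apply_of_not_lowerValid hγ', mul_intertwiner_apply_of_not_upperValid hγ]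

theorem map_pow_mul_conjTranspose_of_lowerPair {c : Colour}
    (hu : SatisfiesGroupRel (lowerPair c c.flip) u) :
    (Matrix.of u).map c.pow * ((Matrix.of u).map c.pow)ᴴ = 1 := by
  let T : Matrix (Fin 2 → Fin N) (Fin 0 → Fin N) A := .of fun t' _ => if t' 0 = t' 1 then 1 else 0
  have h : T * tensorPower ![] u = tensorPower ![c, c.flip] u * T := by
    have h := hu.intertwiner_mul_tensorPower
    rw [intertwiner_lowerPair] at h
    exact h
  ext i j
  simpa [T, tensorPower, tensorProduct, Matrix.mul_apply, Matrix.one_apply, sum_fin_two_ite_eq,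
    Colour.star_pow] using (congrFun₂ h ![i, j] ![]).symm

theorem conjTranspose_mul_map_pow_of_upperPair {c : Colour}
    (hu : SatisfiesGroupRel (upperPair c.flip c) u) :
    ((Matrix.of u).map c.pow)ᴴ * (Matrix.of u).map c.pow = 1 := by
  let T : Matrix (Fin 0 → Fin N) (Fin 2 → Fin N) A := .of fun _ t => if t 0 = t 1 then 1 else 0
  have h : T * tensorPower ![c.flip, c] u = tensorPower ![] u * T := by
    have h := hu.intertwiner_mul_tensorPower
    rw [intertwiner_upperPair] at h
    exact h
  ext i j
  simpa [T, tensorPower, tensorProduct, Matrix.mul_apply, Matrix.one_apply, sum_fin_two_ite_eq,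
    Colour.star_pow] using congrFun₂ h ![] ![i, j]

theorem SatisfiesGroupRel.tensorPower_mul_transpose_intertwiner
    (hpair : ∀ q ∈ mixedPairs, SatisfiesGroupRel q u) (hu : SatisfiesGroupRel p u) :
    tensorPower p.ω u * (intertwiner A N p)ᵀ = (intertwiner A N p)ᵀ * tensorPower p.ω' u := by
  have hlower (c : Colour) : lowerPair c c.flip ∈ mixedPairs := by
    cases c <;> simp [mixedPairs, Colour.flip]
  have hupper (c : Colour) : upperPair c.flip c ∈ mixedPairs := by
    cases c <;> simp [mixedPairs, Colour.flip]
  rw [← conjTranspose_intertwiner]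
  exact mul_conjTranspose_of_intertwines
    (tensorProduct_mul_conjTranspose fun m =>
      map_pow_mul_conjTranspose_of_lowerPair (hpair _ (hlower (p.ω m))))
    (conjTranspose_mul_tensorProduct fun m =>
      conjTranspose_mul_map_pow_of_upperPair (hpair _ (hupper (p.ω' m))))
    hu.intertwiner_mul_tensorPower

end Relations

/-! ### The quantum group relations imply the quantum space relations -/

namespace SatisfiesGroupRel

variable {A : Type*} [Ring A] [StarRing A] {p : ColouredPartition} {N : ℕ}
  {u : Fin N → Fin N → A}

theorem sum_upperT_eq_sum_lowerT_of_row (hpair : ∀ q ∈ mixedPairs, SatisfiesGroupRel q u)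
    (hu : SatisfiesGroupRel p u) {i j : p.ThroughBlock → Fin N} {δ : Fin p.k → Fin N}
    {γ' : Fin p.l → Fin N} (hδ : δ ∈ p.upperT N i) (hγ' : γ' ∈ p.lowerT N j) :
    ∑ t ∈ p.upperT N j, word p.ω (fun m => u (δ m) (t m)) =
      ∑ t' ∈ p.lowerT N i, word p.ω' fun m => u (t' m) (γ' m) := by
  have h := congrFun₂ (hu.tensorPower_mul_transpose_intertwiner hpair) δ γ'
  rwa [mul_transpose_intertwiner_apply hγ', transpose_intertwiner_mul_apply hδ] at h

theorem sum_lowerT_eq_zero (hpair : ∀ q ∈ mixedPairs, SatisfiesGroupRel q u)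
    (hu : SatisfiesGroupRel p u) (i : p.ThroughBlock → Fin N) {γ' : Fin p.l → Fin N}
    (hγ' : ¬ p.LowerValid γ') :
    ∑ t' ∈ p.lowerT N i, word p.ω' (fun m => u (t' m) (γ' m)) = 0 := by
  obtain ⟨b, -⟩ := not_forall.1 hγ'
  obtain ⟨δ, hδ⟩ : (p.upperT N i).Nonempty :=
    ⟨_, p.relabel_mem_upperT (t := fun _ => γ' b) (fun _ _ _ => rfl) i⟩
  have h := congrFun₂ (hu.tensorPower_mul_transpose_intertwiner hpair) δ γ'
  rw [mul_transpose_intertwiner_apply_of_not_lowerValid hγ',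
    transpose_intertwiner_mul_apply hδ] at h
  exact h.symm

theorem sum_upperT_eq_sum_lowerT [IsAddTorsionFree A]
    (hpair : ∀ q ∈ mixedPairs, SatisfiesGroupRel q u) (hu : SatisfiesGroupRel p u)
    (i : p.ThroughBlock → Fin N) {j : p.ThroughBlock → Fin N} {γ : Fin p.k → Fin N}
    {γ' : Fin p.l → Fin N} (hγ : γ ∈ p.upperT N j) (hγ' : γ' ∈ p.lowerT N j) :
    ∑ t ∈ p.upperT N i, word p.ω (fun m => u (t m) (γ m)) =
      ∑ t' ∈ p.lowerT N i, word p.ω' fun m => u (t' m) (γ' m) := by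
  have hδ := p.relabel_mem_upperT (p.mem_upperT.1 hγ).1 i
  have hδ' := p.relabel_mem_lowerT (p.mem_lowerT.1 hγ').1 i
  exact colSum_eq_rowSum_of_card_eq (p.card_upperT_eq i j) ⟨_, hδ⟩
    (f := fun t s => word p.ω fun m => u (t m) (s m))
    (fun s hs => (hu (.through i j s _ hs hδ')).trans (hu (.through i j γ _ hγ hδ')).symm)
    (fun t ht => hu.sum_upperT_eq_sum_lowerT_of_row hpair ht hγ')

theorem satisfiesSpaceRel [IsAddTorsionFree A] (hpair : ∀ q ∈ mixedPairs, SatisfiesGroupRel q u)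
    (hu : SatisfiesGroupRel p u) {d : ℕ} (hdN : d ≤ N) :
    SatisfiesSpaceRel p hdN fun i j => u i (Fin.castLE hdN j) := by
  rintro _ _ (⟨i, j, γ, γ', hγ, hγ'⟩ | ⟨i, γ, hγ⟩ | ⟨i, γ', hγ'⟩)
  · exact hu.sum_upperT_eq_sum_lowerT hpair i hγ hγ'
  · exact hu (.upper i _ hγ)
  · exact hu.sum_lowerT_eq_zero hpair i hγ'

theorem satisfiesVectorRel [IsAddTorsionFree A]
    (hpair : ∀ q ∈ mixedPairs, SatisfiesGroupRel q u) (hu : SatisfiesGroupRel p u) (j : Fin N) :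
    SatisfiesVectorRel p fun i => u i j := by
  rintro _ _ ⟨i⟩
  have hγ : (fun _ => j) ∈ p.upperT N fun _ => j :=
    p.mem_upperT.2 ⟨fun _ _ _ => rfl, fun _ _ _ => rfl⟩
  have hγ' : (fun _ => j) ∈ p.lowerT N fun _ => j :=
    p.mem_lowerT.2 ⟨fun _ _ _ => rfl, fun _ _ _ => rfl⟩
  exact hu.sum_upperT_eq_sum_lowerT hpair i hγ hγ'

end SatisfiesGroupRel

/-! ### Images of the relations under ⋆-homomorphisms -/

section Map

variable {A B F : Type*} [Ring A] [StarRing A] [Ring B] [StarRing B] [FunLike F A B]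

theorem Colour.map_pow [StarHomClass F A B] (f : F) (c : Colour) (a : A) :
    f (c.pow a) = c.pow (f a) := by
  cases c
  · rfl
  · exact map_star f a

variable [RingHomClass F A B] [StarHomClass F A B]

theorem map_word (f : F) {n : ℕ} (ω : Fin n → Colour) (y : Fin n → A) :
    f (word ω y) = word ω fun m => f (y m) := by
  simp only [word, map_list_prod, List.map_ofFn, Function.comp_def, Colour.map_pow]

theorem GroupRel.exists_of_map (f : F) {p : ColouredPartition} {N : ℕ} {u : Fin N → Fin N → A}
    {a' b' : B} (h : GroupRel p (fun i j => f (u i j)) a' b') :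
    ∃ a b, GroupRel p u a b ∧ f a = a' ∧ f b = b' := by
  rcases h with ⟨i, j, γ, γ', hγ, hγ'⟩ | ⟨i, γ, hγ⟩ | ⟨j, γ', hγ'⟩
  · exact ⟨_, _, .through i j γ γ' hγ hγ', by simp only [map_sum, map_word],
      by simp only [map_sum, map_word]⟩
  · exact ⟨_, _, .upper i γ hγ, by simp only [map_sum, map_word], map_zero f⟩
  · exact ⟨_, _, .lower j γ' hγ', by simp only [map_sum, map_word], map_zero f⟩

theorem SpaceRel.map (f : F) {p : ColouredPartition} {N d : ℕ} {hdN : d ≤ N}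
    {x : Fin N → Fin d → A} {a b : A} (h : SpaceRel p hdN x a b) :
    SpaceRel p hdN (fun i j => f (x i j)) (f a) (f b) := by
  rcases h with ⟨i, j, γ, γ', hγ, hγ'⟩ | ⟨i, γ, hγ⟩ | ⟨i, γ', hγ'⟩ <;>
    simp only [map_sum, map_word, map_zero]
  · exact .through i j γ γ' hγ hγ'
  · exact .upper i γ hγ
  · exact .lower i γ' hγ'

theorem VectorRel.map (f : F) {p : ColouredPartition} {N : ℕ} {x : Fin N → A} {a b : A}
    (h : VectorRel p x a b) : VectorRel p (fun i => f (x i)) (f a) (f b) := by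
  rcases h with ⟨i⟩
  simp only [map_sum, map_word]
  exact .through i

end Map

/-! ### The universal property -/

namespace FreeStarAlgebra

variable {ι B : Type*}

/-- The evaluation of words in the generators and their adjoints at a family `y`. -/
def wordLift [Monoid B] [Star B] (y : ι → B) : FreeMonoid (ι × Colour) →* B :=
  FreeMonoid.lift fun s => s.2.pow (y s.1)

theorem wordLift_wordStar [Monoid B] [StarMul B] (y : ι → B) (w : FreeMonoid (ι × Colour)) :
    wordLift y (wordStar w) = star (wordLift y w) := by
  induction w using FreeMonoid.inductionOn with
  | one => exact (star_one B).symm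
  | of s => exact (Colour.star_pow s.2 (y s.1)).symm
  | mul v w hv hw => rw [wordStar_mul, map_mul, map_mul, hv, hw, star_mul]

section Lift

variable [Semiring B] [StarRing B] [Algebra ℂ B] [StarModule ℂ B]

/-- The ⋆-homomorphism on the free ⋆-algebra that sends the generators to the family `y`. -/
noncomputable def lift (y : ι → B) : FreeStarAlgebra ι →⋆ₐ[ℂ] B where
  __ := MonoidAlgebra.lift ℂ B (FreeMonoid (ι × Colour)) (wordLift y)
  map_star' f := by
    change MonoidAlgebra.lift ℂ B (FreeMonoid (ι × Colour)) (wordLift y) (starHom f) =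
      star (MonoidAlgebra.lift ℂ B (FreeMonoid (ι × Colour)) (wordLift y) f)
    induction f using MonoidAlgebra.induction_linear with
    | zero => simp
    | add f g hf hg => rw [map_add, map_add, map_add, star_add, hf, hg]
    | single w c =>
      rw [starHom_single, MonoidAlgebra.lift_single, MonoidAlgebra.lift_single,
        wordLift_wordStar, star_smul]

theorem lift_gen (y : ι → B) (i : ι) : lift y (gen i) = y i := by
  change MonoidAlgebra.lift ℂ B (FreeMonoid (ι × Colour)) (wordLift y) (gen i) = y i
  rw [gen, MonoidAlgebra.lift_single, one_smul]
  rfl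

end Lift

theorem single_black (i : ι) :
    (MonoidAlgebra.single (FreeMonoid.of (i, Colour.black)) 1 : FreeStarAlgebra ι) =
      star (gen i) := by
  change _ = starHom _
  rw [gen, starHom_single, star_one]
  rfl

theorem hom_ext [Semiring B] [StarRing B] [Algebra ℂ B] {f g : FreeStarAlgebra ι →⋆ₐ[ℂ] B}
    (h : ∀ i, f (gen i) = g (gen i)) : f = g := by
  have hletter : ∀ s : ι × Colour, f (MonoidAlgebra.single (FreeMonoid.of s) 1) =
      g (MonoidAlgebra.single (FreeMonoid.of s) 1) := by
    rintro ⟨i, _ | _⟩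
    · exact h i
    · rw [single_black, map_star, map_star, h]
  have halg : (f : FreeStarAlgebra ι →ₐ[ℂ] B) = (g : FreeStarAlgebra ι →ₐ[ℂ] B) :=
    MonoidAlgebra.algHom_ext' (FreeMonoid.hom_eq hletter) (Subsingleton.elim _ _)
  exact StarAlgHom.ext fun a => DFunLike.congr_fun halg a

end FreeStarAlgebra

namespace CStarSeminorm

variable {A : Type*} [Ring A] [StarRing A] [Algebra ℂ A]

/-- The canonical map from `A` to its completion as a ⋆-homomorphism. -/
def ofHom (p : CStarSeminorm A) : A →⋆ₐ[ℂ] p.Completion where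
  toFun := p.of
  map_one' := p.of_one
  map_mul' := p.of_mul
  map_zero' := rfl
  map_add' := p.of_add
  commutes' c := by
    rw [Algebra.algebraMap_eq_smul_one, of_smul, of_one, Algebra.algebraMap_eq_smul_one]
  map_star' a := (p.star_of a).symm

/-- The C⋆-seminorm `a ↦ ‖f a‖` induced by a ⋆-homomorphism `f`. -/
def comap {B : Type*} [NormedRing B] [StarRing B] [CStarRing B] [NormedAlgebra ℂ B]
    (f : A →⋆ₐ[ℂ] B) : CStarSeminorm A where
  toFun a := ‖f a‖
  map_zero' := by rw [map_zero, norm_zero]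
  add_le' a b := by simpa only [map_add] using norm_add_le (f a) (f b)
  neg' a := by rw [map_neg, norm_neg]
  smul' c a := by rw [map_smul, norm_smul]
  mul_le' a b := by simpa only [map_mul] using norm_mul_le (f a) (f b)
  star_mul_self' a := by rw [map_mul, StarHomClass.map_star, CStarRing.norm_star_mul_self, sq]

section Extend

variable (p : CStarSeminorm A) {B : Type*} [NormedRing B]

/-- A ring homomorphism on `A`, regarded as one on `A` with the topology given by `p`. -/
def carrierHom (f : A →+* B) : p.Carrier →+* B := f

theorem continuous_carrierHom {f : A →+* B} (hf : ∀ a, ‖f a‖ ≤ p a) :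
    Continuous (p.carrierHom f) :=
  AddMonoidHomClass.continuous_of_bound (p.carrierHom f) 1 fun a => (hf a).trans (one_mul _).ge

variable [CompleteSpace B]

/-- The continuous extension of a contractive ring homomorphism to the completion. -/
noncomputable def extendRingHom (f : A →+* B) (hf : ∀ a, ‖f a‖ ≤ p a) : p.Completion →+* B :=
  UniformSpace.Completion.extensionHom (p.carrierHom f) (p.continuous_carrierHom hf)

theorem extendRingHom_of (f : A →+* B) (hf : ∀ a, ‖f a‖ ≤ p a) (a : A) :
    p.extendRingHom f hf (p.of a) = f a :=
  UniformSpace.Completion.extensionHom_coe (α := p.Carrier) _ (p.continuous_carrierHom hf) a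

theorem continuous_extendRingHom (f : A →+* B) (hf : ∀ a, ‖f a‖ ≤ p a) :
    Continuous (p.extendRingHom f hf) :=
  UniformSpace.Completion.continuous_extension

variable [StarRing B] [ContinuousStar B] [Algebra ℂ B]

/-- The continuous extension of a contractive ⋆-homomorphism to the completion. -/
noncomputable def extend (f : A →⋆ₐ[ℂ] B) (hf : ∀ a, ‖f a‖ ≤ p a) : p.Completion →⋆ₐ[ℂ] B where
  __ := p.extendRingHom (f : A →+* B) hf
  commutes' c := by
    change p.extendRingHom (f : A →+* B) hf _ = _
    rw [← AlgHomClass.commutes p.ofHom c]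
    exact (p.extendRingHom_of _ hf _).trans (AlgHomClass.commutes f c)
  map_star' a := by
    change p.extendRingHom (f : A →+* B) hf _ = star (p.extendRingHom (f : A →+* B) hf _)
    refine p.completion_induction a
      (P := fun a => p.extendRingHom (f : A →+* B) hf (star a) =
        star (p.extendRingHom (f : A →+* B) hf a))
      (isClosed_eq ((p.continuous_extendRingHom _ hf).comp p.continuous_star_completion)
        (p.continuous_extendRingHom _ hf).star) fun a => ?_
    rw [star_of]
    exact (p.extendRingHom_of _ hf _).trans
      ((StarHomClass.map_star f a).trans (congrArg star (p.extendRingHom_of _ hf a)).symm)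

theorem extend_of (f : A →⋆ₐ[ℂ] B) (hf : ∀ a, ‖f a‖ ≤ p a) (a : A) :
    p.extend f hf (p.of a) = f a :=
  p.extendRingHom_of _ hf a

end Extend

end CStarSeminorm

namespace UniversalCStarAlgebra

open scoped CStarAlgebra

variable {ι : Type*} {R : FreeStarAlgebra ι → FreeStarAlgebra ι → Prop} (hR : BoundedRelations R)

theorem of_eq_of_rel {a b : FreeStarAlgebra ι} (h : R a b) :
    (universalSeminorm hR).ofHom a = (universalSeminorm hR).ofHom b := by
  have hzero : universalSeminorm hR (a - b) = 0 :=
    (iSup_congr fun p : AdmissibleSeminorm R => p.2 a b h).trans ciSup_const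
  rw [← sub_eq_zero, ← map_sub, ← norm_eq_zero]
  exact ((universalSeminorm hR).norm_of _).trans hzero

variable {B : Type*} [CStarAlgebra B]

theorem norm_freeLift_le {y : ι → B}
    (hy : ∀ ⦃a b⦄, R a b → FreeStarAlgebra.lift y a = FreeStarAlgebra.lift y b)
    (a : FreeStarAlgebra ι) : ‖FreeStarAlgebra.lift y a‖ ≤ universalSeminorm hR a := by
  let q : AdmissibleSeminorm R := ⟨.comap (FreeStarAlgebra.lift y), fun a b h => by
    change ‖FreeStarAlgebra.lift y (a - b)‖ = 0
    rw [map_sub, hy h, sub_self, norm_zero]⟩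
  exact hR.le_iSup q a

theorem hom_ext {φ ψ : UniversalCStarAlgebra hR →⋆ₐ[ℂ] B}
    (h : ∀ i, φ (gen hR i) = ψ (gen hR i)) : φ = ψ := by
  have hfree : φ.comp (universalSeminorm hR).ofHom = ψ.comp (universalSeminorm hR).ofHom :=
    FreeStarAlgebra.hom_ext h
  exact StarAlgHom.ext fun a => (universalSeminorm hR).completion_induction a
    (isClosed_eq (map_continuous φ) (map_continuous ψ)) (DFunLike.congr_fun hfree)

theorem existsUnique_hom {y : ι → B}
    (hy : ∀ ⦃a b⦄, R a b → FreeStarAlgebra.lift y a = FreeStarAlgebra.lift y b) :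
    ∃! φ : UniversalCStarAlgebra hR →⋆ₐ[ℂ] B, ∀ i, φ (gen hR i) = y i := by
  have hgen (i : ι) :
      (universalSeminorm hR).extend _ (norm_freeLift_le hR hy) (gen hR i) = y i :=
    (CStarSeminorm.extend_of _ _ _ _).trans (FreeStarAlgebra.lift_gen y i)
  exact ⟨_, hgen, fun ψ hψ => hom_ext hR fun i => (hψ i).trans (hgen i).symm⟩

end UniversalCStarAlgebra

section Objects

variable {N d : ℕ} {hdN : d ≤ N} {P : Set ColouredPartition} {hP : mixedPairs ⊆ P}

theorem EasyQuantumGroup.satisfiesGroupRel_u {p : ColouredPartition} (hp : p ∈ P) :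
    SatisfiesGroupRel p (EasyQuantumGroup.u N P hP) := by
  intro _ _ h
  obtain ⟨a, b, hab, rfl, rfl⟩ := GroupRel.exists_of_map
    (universalSeminorm (easyRelations_bounded N hP)).ofHom
    (u := fun i j => FreeStarAlgebra.gen (i, j)) h
  exact UniversalCStarAlgebra.of_eq_of_rel _ ⟨p, hp, hab⟩

variable {B : Type*} [CStarAlgebra B]

theorem PartitionSpace.existsUnique_hom {x : Fin N → Fin d → B}
    (hx : ∀ p ∈ P, SatisfiesSpaceRel p hdN x) :
    ∃! φ : PartitionSpace N d hdN P hP →⋆ₐ[ℂ] B,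
      ∀ i j, φ (PartitionSpace.x N d hdN P hP i j) = x i j := by
  have h := UniversalCStarAlgebra.existsUnique_hom (spaceRelations_bounded N d hdN hP)
    (y := fun s => x s.1 s.2) fun a b ⟨p, hp, hab⟩ => by
      have hab' := hab.map (FreeStarAlgebra.lift fun s : Fin N × Fin d => x s.1 s.2)
      simp only [FreeStarAlgebra.lift_gen] at hab'
      exact hx p hp hab'
  simp only [Prod.forall] at h
  exact h

theorem OneVectorSpace.existsUnique_hom {x : Fin N → B} (hx : ∀ p ∈ P, SatisfiesVectorRel p x) :
    ∃! φ : OneVectorSpace N P hP →⋆ₐ[ℂ] B, ∀ i, φ (OneVectorSpace.x N P hP i) = x i := by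
  refine UniversalCStarAlgebra.existsUnique_hom (vectorRelations_bounded N hP)
    fun a b ⟨p, hp, hab⟩ => ?_
  have hab' := hab.map (FreeStarAlgebra.lift x)
  simp only [FreeStarAlgebra.lift_gen] at hab'
  exact hx p hp hab'

end Objects

end PartitionQuantumSpace

open PartitionQuantumSpace in
theorem mainTheorem1 (N d : ℕ) (hd : 1 ≤ d) (hdN : d ≤ N) (P : Set ColouredPartition)
    (hP : ColouredPartition.mixedPairs ⊆ P) :
    (∃! φ : PartitionSpace N d hdN P hP →⋆ₐ[ℂ] EasyQuantumGroup N P hP,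
      ∀ (i : Fin N) (j : Fin d), φ (PartitionSpace.x N d hdN P hP i j) =
        EasyQuantumGroup.u N P hP i (Fin.castLE hdN j)) ∧
    (∃! φ : OneVectorSpace N P hP →⋆ₐ[ℂ] EasyQuantumGroup N P hP,
      ∀ i : Fin N, φ (OneVectorSpace.x N P hP i) =
        EasyQuantumGroup.u N P hP i ⟨0, Nat.lt_of_lt_of_le hd hdN⟩) := by
  have hu : ∀ p ∈ P, SatisfiesGroupRel p (EasyQuantumGroup.u N P hP) :=
    fun p hp => EasyQuantumGroup.satisfiesGroupRel_u hp
  have hpair : ∀ q ∈ ColouredPartition.mixedPairs,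
      SatisfiesGroupRel q (EasyQuantumGroup.u N P hP) := fun q hq => hu q (hP hq)
  let _ : Module ℚ (EasyQuantumGroup N P hP) := Module.compHom _ (algebraMap ℚ ℂ)
  have : IsAddTorsionFree (EasyQuantumGroup N P hP) := .of_module_rat _
  exact ⟨PartitionSpace.existsUnique_hom fun p hp => (hu p hp).satisfiesSpaceRel hpair hdN,
    OneVectorSpace.existsUnique_hom fun p hp => (hu p hp).satisfiesVectorRel hpair _⟩
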